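/- A divisor in $\mathbb{P}^2(\mathbb{C})$ is a finite formal sum $D=\sum_{i=1}^m s_iP_i$ of pairwise distinct points $P_i\in\mathbb{P}^2(\mathbb{C})$ with coefficients $s_i\in\mathbb{Z}$; its degree is $\sum_i s_i$. It is called a Hausdorff divisor if, for every $i$, $s_i=1$ and $P_i$ is of the form $(a:b:0)$. A projective plane curve of degree $n$ is a nonzero homogeneous polynomial $F(x,y,z)\in\mathbb{C}[x,y,z]$ of degree $n$, up to multiplication by a nonzero constant; it is irreducible if $F$ is irreducible over $\mathbb{C}$. For a divisor $D$ with all $s_i\ge 0$, $\mathcal{H}(n,D)$ denotes the linear system of all projective plane curves of degree $n$ that pass through $P_i$ with multiplicity at least $s_i$ for every $i$ (that is, all partial derivatives of $F$ of order less than $s_i$ vanish at $P_i$). For a curve $\mathcal{C}$ defined by $F(x,y,z)$ and different from the line $z=0$, $\mathcal{C}_a$ denotes the affine curve defined by $F(x,y,1)$, and $\deg(\mathcal{C}_a)$ is the total degree of $F(x,y,1)$; $\mathcal{C}$ is real if $\mathcal{C}_a$ contains infinitely many real points. Let $\mathrm{H}$ denote the Hausdorff distance, with values in $[0,\infty]$,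 between subsets of $\mathbb{R}^2$ with the Euclidean metric. **Theorem.** Let $n$ be a positive integer and let $D$ be a Hausdorff divisor of degree $n$. For every two real irreducible curves $\mathcal{C}_1,\mathcal{C}_2\in\mathcal{H}(n,D)$ such that $\deg(\mathcal{C}_{1,a})=\deg(\mathcal{C}_{2,a})=n$, it holds that $$\mathrm{H}(\mathcal{C}_{1,a}\cap\mathbb{R}^2,\ \mathcal{C}_{2,a}\cap\mathbb{R}^2)<\infty.$$ -/

import Mathlib

open scoped LinearAlgebra.Projectivization

namespace HausdorffDivisor

open MvPolynomial

/-- The complex projective plane `ℙ²(ℂ)`, with homogeneous coordinates `(x : y : z)` indexed by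
`0, 1, 2`. -/
abbrev ProjPlane : Type := ℙ ℂ (Fin 3 → ℂ)

/-- A divisor in `ℙ²(ℂ)`: a formal finite sum `∑ sᵢ Pᵢ` of distinct points with integer
multiplicities. Its degree `∑ sᵢ` is `Finsupp.degree`. -/
abbrev Divisor : Type := ProjPlane →₀ ℤ

/-- A point of `ℙ²(ℂ)` of the form `(a : b : 0)`. -/
def IsAtInfinity (P : ProjPlane) : Prop :=
  ∃ (a b : ℂ) (h : (![a, b, 0] : Fin 3 → ℂ) ≠ 0), P = Projectivization.mk ℂ ![a, b, 0] h

/-- A Hausdorff divisor: every point that occurs has multiplicity one and lies on `z = 0`. -/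
def Divisor.IsHausdorff (D : Divisor) : Prop :=
  ∀ P ∈ D.support, D P = 1 ∧ IsAtInfinity P

/-- Projective plane curves of degree `n`: nonzero complex forms of degree `n` in three variables,
up to a nonzero scalar. -/
abbrev PlaneCurve (n : ℕ) : Type := ℙ ℂ (homogeneousSubmodule (Fin 3) ℂ n)

/-- A form defining the curve (unique up to a nonzero scalar). -/
noncomputable def PlaneCurve.form {n : ℕ} (C : PlaneCurve n) : MvPolynomial (Fin 3) ℂ :=
  (C.rep : MvPolynomial (Fin 3) ℂ)

/-- The curve `F = 0` passes through `P` with multiplicity at least `s`: all partial derivatives of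
`F` of order less than `s`, that is `∂_{i₁} ⋯ ∂_{iₖ} F` with `k < s`, vanish at `P`. -/
def HasMultiplicityGE (F : MvPolynomial (Fin 3) ℂ) (P : ProjPlane) (s : ℤ) : Prop :=
  ∀ l : List (Fin 3), (l.length : ℤ) < s →
    eval P.rep (l.foldr (fun i G => pderiv i G) F) = 0

/-- The linear system `ℋ(n, D)`: all curves of degree `n` passing through each point `P` with
multiplicity at least the coefficient of `P` in `D`. -/
def linearSystem (n : ℕ) (D : Divisor) : Set (PlaneCurve n) :=
  {C | ∀ P : ProjPlane, HasMultiplicityGE C.form P (D P)}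

/-- A curve is irreducible if its defining form is irreducible over `ℂ`. -/
def PlaneCurve.IsIrreducible {n : ℕ} (C : PlaneCurve n) : Prop :=
  Irreducible C.form

/-- The polynomial `F(x, y, 1)` defining the affine part of the curve `F(x, y, z) = 0`. -/
noncomputable def PlaneCurve.affinePoly {n : ℕ} (C : PlaneCurve n) : MvPolynomial (Fin 2) ℂ :=
  aeval ![X 0, X 1, 1] C.form

/-- The degree of the affine part of a curve. -/
noncomputable def PlaneCurve.affineDegree {n : ℕ} (C : PlaneCurve n) : ℕ :=
  C.affinePoly.totalDegree

/-- The set of real points of the affine part of a curve, as a subset of the Euclidean plane. -/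
def PlaneCurve.realAffinePart {n : ℕ} (C : PlaneCurve n) : Set (EuclideanSpace ℝ (Fin 2)) :=
  {p | eval (fun i => (p i : ℂ)) C.affinePoly = 0}

/-- A curve is real if its affine part has infinitely many real points. -/
def PlaneCurve.IsReal {n : ℕ} (C : PlaneCurve n) : Prop :=
  C.realAffinePart.Infinite

end HausdorffDivisor

section

open MvPolynomial Filter Topology

/-! Since the affine degree is `n`, the form `F(x, y, 0)` is nonzero of degree `n`. It vanishes at
the `n` distinct points of the divisor, so these are all its zeros and they are simple
(`zero_at_infinity`). Hence both curves meet the line at infinity in the same points, and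
transversally.

Near a real common point `u`, at height `z > 0`, the zeros of either form lie within `O(z)` of the
line through the origin and `u`. Returning to the affine plane divides by `z`, so the two curves
stay a bounded distance apart there (`exists_eventually_zeroNear`). Compactness of the circle at
infinity makes the bound uniform outside a disc (`exists_bound_affine`); inside the disc any fixed
point of the other curve serves.

The nearby point of the other curve must be real. It is found by a sign change, so each curve needs
a real equation; an irreducible form with infinitely many real zeros has one (`exists_real_form`),
because it divides its complex conjugate. -/

theorem MvPolynomial.IsHomogeneous.eval_smul_vec {σ R : Type*} [CommSemiring R]
    {F : MvPolynomial σ R} {n : ℕ} (hF : F.IsHomogeneous n) (t : R) (x : σ → R) :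
    eval (t • x) F = t ^ n * eval x F := by
  rw [eval_eq, eval_eq, Finset.mul_sum]
  refine Finset.sum_congr rfl fun d hd => ?_
  rw [hF.degree_eq_sum_deg_support hd, Finset.prod_congr rfl fun i _ => by
    rw [Pi.smul_apply, smul_eq_mul, mul_pow], Finset.prod_mul_distrib, Finset.prod_pow_eq_pow_sum]
  ring

/-! ### Common zeros of plane curves and real equations -/

/-- The ideal of the line through the origin and `(a, b, 1)`. -/
noncomputable def lineIdeal {K : Type*} [Field K] (p : K × K) : Ideal (MvPolynomial (Fin 3) K) :=
  Ideal.span {X 0 - C p.1 * X 2, X 1 - C p.2 * X 2}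

/-- Modulo the ideal, substituting the parametrization of the line changes no variable, hence no
class. The kernel description yields primality. -/
theorem lineIdeal_eq_ker {K : Type*} [Field K] (p : K × K) :
    lineIdeal p = RingHom.ker (aeval (R := K) ![C p.1 * X 2, C p.2 * X 2, (X 2 :
      MvPolynomial (Fin 3) K)]).toRingHom := by
  apply le_antisymm
  · rw [lineIdeal, Ideal.span_le]
    rintro q (rfl | rfl) <;> simp [RingHom.mem_ker]
  · intro q hq
    have key : (Ideal.Quotient.mkₐ K (lineIdeal p)).comp
        (aeval (R := K) ![C p.1 * X 2, C p.2 * X 2, (X 2 : MvPolynomial (Fin 3) K)])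
        = Ideal.Quotient.mkₐ K (lineIdeal p) := by
      apply MvPolynomial.algHom_ext
      intro i
      simp only [AlgHom.comp_apply, aeval_X, Ideal.Quotient.mkₐ_eq_mk]
      rw [eq_comm, Ideal.Quotient.eq]
      fin_cases i
      · exact Ideal.subset_span (by simp)
      · exact Ideal.subset_span (by simp)
      · simp
    have := congrArg (fun f => f q) key
    simp only [AlgHom.comp_apply, Ideal.Quotient.mkₐ_eq_mk] at this
    rw [← Ideal.Quotient.eq_zero_iff_mem, ← this]
    have hq' : (aeval (R := K) ![C p.1 * X 2, C p.2 * X 2, (X 2 : MvPolynomial (Fin 3) K)]) q = 0 :=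
      hq
    rw [hq', map_zero]

instance {K : Type*} [Field K] (p : K × K) : (lineIdeal p).IsPrime := by
  rw [lineIdeal_eq_ker]
  exact RingHom.ker_isPrime _

/-- By homogeneity a zero at `(a, b, 1)` propagates to the whole line, and over an infinite field a
polynomial vanishing as a function is zero. -/
theorem mem_lineIdeal {K : Type*} [Field K] [Infinite K] (p : K × K) {F : MvPolynomial (Fin 3) K}
    {n : ℕ} (hF : F.IsHomogeneous n) (h : eval ![p.1, p.2, 1] F = 0) : F ∈ lineIdeal p := by
  rw [lineIdeal_eq_ker, RingHom.mem_ker]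
  change aeval _ F = 0
  refine MvPolynomial.funext fun v => ?_
  have : eval v (aeval ![C p.1 * X 2, C p.2 * X 2, (X 2 : MvPolynomial (Fin 3) K)] F)
      = eval (v 2 • ![p.1, p.2, 1]) F := by
    rw [← coe_aeval_eq_eval, ← coe_aeval_eq_eval]
    simp only [RingHom.coe_coe]
    rw [← AlgHom.comp_apply]
    congr 1
    apply MvPolynomial.algHom_ext
    intro i
    fin_cases i <;> simp [mul_comm]
  rw [this, hF.eval_smul_vec, h, mul_zero, map_zero]

theorem lineIdeal_injective {K : Type*} [Field K] : Function.Injective (lineIdeal (K := K)) := by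
  intro p q h
  have h0 : X 0 - C p.1 * X 2 ∈ lineIdeal q := h ▸ Ideal.subset_span (by simp)
  have h1 : X 1 - C p.2 * X 2 ∈ lineIdeal q := h ▸ Ideal.subset_span (by simp)
  rw [lineIdeal_eq_ker, RingHom.mem_ker] at h0 h1
  have e0 := congrArg (eval (fun _ => 1)) h0
  have e1 := congrArg (eval (fun _ => 1)) h1
  simp at e0 e1
  exact Prod.ext (sub_eq_zero.1 e0).symm (sub_eq_zero.1 e1).symm

theorem height_lineIdeal_le {K : Type*} [Field K] (p : K × K) : (lineIdeal p).height ≤ 2 := by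
  have h := Ideal.height_le_card_of_mem_minimalPrimes_span (s := {X 0 - C p.1 * X 2,
    X 1 - C p.2 * X 2}) (p := lineIdeal p) (Set.toFinite _) (by
      change lineIdeal p ∈ (lineIdeal p).minimalPrimes
      rw [Ideal.minimalPrimes_eq_subsingleton_self]
      rfl)
  refine h.trans ?_
  have := (Set.ncard_insert_le (X 0 - C p.1 * X 2) {(X 1 - C p.2 * X 2 :
    MvPolynomial (Fin 3) K)})
  rw [Set.ncard_singleton] at this
  exact_mod_cast this

/-- Two plane curves without common component have finitely many common affine points. -/
theorem finite_common_zeros {K : Type*} [Field K] [Infinite K] {F H : MvPolynomial (Fin 3) K}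
    {n m : ℕ} (hF : F.IsHomogeneous n) (hH : H.IsHomogeneous m) (hirr : Irreducible F)
    (hdvd : ¬ F ∣ H) :
    {p : K × K | eval ![p.1, p.2, 1] F = 0 ∧ eval ![p.1, p.2, 1] H = 0}.Finite := by
  refine Set.Finite.of_finite_image (f := lineIdeal) ?_ lineIdeal_injective.injOn
  -- Each common zero gives a minimal prime over `(F, H)`, and a Noetherian ring has only finitely
  -- many of these.
  refine (Ideal.finite_minimalPrimes_of_isNoetherianRing _ (Ideal.span {F, H})).subset ?_
  rintro _ ⟨p, ⟨h1, h2⟩, rfl⟩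
  have hle : Ideal.span {F, H} ≤ lineIdeal p := by
    rw [Ideal.span_le]
    rintro q (rfl | rfl)
    exacts [mem_lineIdeal p hF h1, mem_lineIdeal p hH h2]
  obtain ⟨P, hP, hPle⟩ := Ideal.exists_minimalPrimes_le hle
  have := hP.isPrime
  obtain rfl | hlt := hPle.eq_or_lt
  · exact hP
  -- Otherwise `0 < (F) < P < lineIdeal p` is a chain of primes, against height at most 2.
  exfalso
  have hprime : (Ideal.span {F}).IsPrime :=
    (Ideal.span_singleton_prime hirr.ne_zero).2 hirr.prime
  have l1 : (⊥ : Ideal (MvPolynomial (Fin 3) K)) < Ideal.span {F} := by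
    rw [bot_lt_iff_ne_bot, Ne, Ideal.span_singleton_eq_bot]
    exact hirr.ne_zero
  have l2 : Ideal.span {F} < P := by
    refine lt_of_le_of_ne ((Ideal.span_mono (by simp)).trans hP.1.2) ?_
    rintro rfl
    exact hdvd (Ideal.mem_span_singleton.1 (hP.1.2 (Ideal.subset_span (by simp))))
  have i1 := Ideal.height_add_one_le_of_lt_of_isPrime l1
  have i2 := Ideal.height_add_one_le_of_lt_of_isPrime l2
  have i3 := Ideal.height_add_one_le_of_lt_of_isPrime hlt
  have i4 := height_lineIdeal_le p
  have : (0 + 1 + 1 + 1 : ℕ∞) ≤ 2 := by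
    refine le_trans ?_ i4
    refine le_trans ?_ i3
    gcongr
    refine le_trans ?_ i2
    gcongr
    refine le_trans ?_ i1
    gcongr
    exact zero_le
  exact absurd this (by decide)

/-- An irreducible form vanishing at infinitely many real affine points is real up to a scalar. -/
theorem exists_real_form {F : MvPolynomial (Fin 3) ℂ} {n : ℕ} (hF : F.IsHomogeneous n)
    (hirr : Irreducible F)
    (hinf : {p : ℝ × ℝ | eval ![(p.1 : ℂ), (p.2 : ℂ), 1] F = 0}.Infinite) :
    ∃ (c : ℂ) (G : MvPolynomial (Fin 3) ℝ), c ≠ 0 ∧ G.IsHomogeneous n ∧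
      F = C c * map Complex.ofRealHom G := by
  -- The real zeros of `F` are also zeros of its conjugate `H`; being infinite in number, they force
  -- `F ∣ H`.
  set H := map (starRingEnd ℂ) F with hHdef
  have hH : H.IsHomogeneous n := hF.map _
  have hdvd : F ∣ H := by
    by_contra hnd
    refine hinf ?_
    have hfin := finite_common_zeros hF hH hirr hnd
    refine (hfin.preimage (f := fun p : ℝ × ℝ => ((p.1 : ℂ), (p.2 : ℂ))) ?_).subset ?_
    · intro p _ q _ h
      simpa [Prod.ext_iff] using h
    · intro p hp
      refine ⟨hp, ?_⟩
      have h0 : eval ![(p.1 : ℂ), (p.2 : ℂ), 1] F = 0 := hp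
      have h1 := congrArg (starRingEnd ℂ) h0
      rw [map_zero] at h1
      rw [hHdef, eval_map, ← h1, eval, coe_eval₂Hom, eval₂_eq, eval₂_eq, map_sum]
      refine Finset.sum_congr rfl fun d _ => ?_
      rw [map_mul, map_prod]
      congr 1
      refine Finset.prod_congr rfl fun i _ => ?_
      fin_cases i <;> simp
  obtain ⟨Q, hQ⟩ := hdvd
  have hF0 := hirr.ne_zero
  have hH0 : H ≠ 0 := fun h => hF0 (map_injective _ (starRingEnd ℂ).injective (by
    rw [← hHdef, h, map_zero]))
  have hQ0 : Q ≠ 0 := by rintro rfl; exact hH0 (by rw [hQ, mul_zero])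
  have hdeg : Q.totalDegree = 0 := by
    have := totalDegree_mul_of_isDomain hF0 hQ0
    rw [← hQ, hH.totalDegree hH0, hF.totalDegree hF0] at this
    omega
  rw [totalDegree_eq_zero_iff_eq_C] at hdeg
  set k := coeff 0 Q
  have hk : ∀ d, starRingEnd ℂ (coeff d F) = k * coeff d F := by
    intro d
    rw [← coeff_map, ← hHdef, hQ, hdeg, mul_comm, coeff_C_mul]
  obtain ⟨d₀, hd₀⟩ := ne_zero_iff.1 hF0
  set α := coeff d₀ F
  have hα : starRingEnd ℂ α = k * α := hk d₀
  have hk0 : k ≠ 0 := by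
    rintro h
    rw [h, zero_mul, map_eq_zero] at hα
    exact hd₀ hα
  -- Conjugation multiplies every coefficient by the same `k`, so it fixes the quotient of any
  -- coefficient by `α`.
  have hmem : C α⁻¹ * F ∈ Set.range (MvPolynomial.map Complex.ofRealHom) := by
    rw [mem_range_map_iff_coeffs_subset]
    intro z hz
    obtain ⟨d, -, rfl⟩ := mem_coeffs_iff.1 hz
    have : starRingEnd ℂ (coeff d (C α⁻¹ * F)) = coeff d (C α⁻¹ * F) := by
      rw [coeff_C_mul, map_mul, map_inv₀, hα, hk]
      have : α ≠ 0 := hd₀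
      field_simp
    obtain ⟨r, hr⟩ := Complex.conj_eq_iff_real.1 this
    exact ⟨r, hr.symm⟩
  obtain ⟨G, hG⟩ := hmem
  refine ⟨α, G, hd₀, ?_, ?_⟩
  · apply IsHomogeneous.of_map (f := Complex.ofRealHom) Complex.ofReal_injective
    rw [hG]
    exact hF.C_mul _
  · rw [hG, ← mul_assoc, ← C_mul, mul_inv_cancel₀ hd₀, C_1, one_mul]

/-! ### Local comparison of zeros near a point at infinity -/

/-- The unit tangent direction at a point `(u₀, u₁, 0)` of the unit circle at infinity. -/
def circleTangent (u : Fin 3 → ℝ) : Fin 3 → ℝ := ![-u 1, u 0, 0]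

/-- The projection of `x` to the line spanned by the point `u` of the circle at infinity. -/
def radialPart (u x : Fin 3 → ℝ) : Fin 3 → ℝ := (u 0 * x 0 + u 1 * x 1) • u

theorem continuous_radialPart (u : Fin 3 → ℝ) : Continuous (radialPart u) := by
  unfold radialPart
  fun_prop

section Circle

variable {u : Fin 3 → ℝ} (hu2 : u 2 = 0) (hu : u 0 ^ 2 + u 1 ^ 2 = 1)
include hu

theorem radialPart_self : radialPart u u = u := by
  have : u 0 * u 0 + u 1 * u 1 = 1 := by rw [← hu]; ring
  rw [radialPart, this, one_smul]

theorem norm_circleTangent_le : ‖circleTangent u‖ ≤ 1 := by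
  rw [pi_norm_le_iff_of_nonneg zero_le_one]
  have h0 : |u 0| ≤ 1 := abs_le.2 ⟨by nlinarith [sq_nonneg (u 1)], by nlinarith [sq_nonneg (u 1)]⟩
  have h1 : |u 1| ≤ 1 := abs_le.2 ⟨by nlinarith [sq_nonneg (u 0)], by nlinarith [sq_nonneg (u 0)]⟩
  intro i
  fin_cases i
  · simpa [circleTangent] using h1
  · simpa [circleTangent] using h0
  · simp [circleTangent]

include hu2 in
theorem eq_radialPart_add (x : Fin 3 → ℝ) :
    x = radialPart u x + ((u 0 * x 1 - u 1 * x 0) • circleTangent u + x 2 • Pi.single 2 1) := by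
  ext i
  fin_cases i
  · simp [radialPart, circleTangent, Matrix.vecHead, Matrix.vecTail]
    linear_combination (-x 0) * hu
  · simp [radialPart, circleTangent, Matrix.vecHead, Matrix.vecTail]
    linear_combination (-x 1) * hu
  · simp [radialPart, circleTangent, Matrix.vecHead, Matrix.vecTail, hu2]

omit hu in
theorem norm_single_two : ‖(Pi.single 2 1 : Fin 3 → ℝ)‖ = 1 := by
  rw [Pi.norm_single, norm_one]

theorem norm_smul_circleTangent_add_le (s ε : ℝ) :
    ‖s • circleTangent u + ε • (Pi.single 2 1 : Fin 3 → ℝ)‖ ≤ |s| + |ε| := by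
  refine (norm_add_le _ _).trans ?_
  rw [norm_smul, norm_smul, norm_single_two, mul_one, Real.norm_eq_abs, Real.norm_eq_abs]
  gcongr
  exact mul_le_of_le_one_right (abs_nonneg _) (norm_circleTangent_le hu)

/-- Near `u`, a zero of `f` is at a distance from the line through `u` that is controlled by the
distance to the line at infinity. -/
theorem eventually_abs_le_mul {f : (Fin 3 → ℝ) → ℝ} {L : (Fin 3 → ℝ) →L[ℝ] ℝ} (hu2 : u 2 = 0)
    (hf : HasStrictFDerivAt f L u) (hL : L (circleTangent u) ≠ 0)
    (hrad : ∀ a : ℝ, f (a • u) = 0) :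
    ∃ M : ℝ, ∀ᶠ x in 𝓝 u, f x = 0 → |u 0 * x 1 - u 1 * x 0| ≤ M * |x 2| := by
  set α := L (circleTangent u)
  set β := L (Pi.single 2 1)
  have hα : 0 < |α| := abs_pos.2 hL
  -- Strict differentiability with error `|α| / 2`, applied to `x` and its radial part, gives
  -- `|σ||α| - |x₂||β| ≤ |α|/2 (|σ| + |x₂|)` for the tangential offset `σ`; the constant comes from
  -- solving for `|σ|`.
  refine ⟨(|β| + |α| / 2) / (|α| / 2), ?_⟩
  have ht : Tendsto (fun x => (x, radialPart u x)) (𝓝 u) (𝓝 (u, u)) := by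
    have : Continuous fun x => (x, radialPart u x) := by
      have := continuous_radialPart u
      fun_prop
    simpa [radialPart_self hu] using this.tendsto u
  filter_upwards [ht.eventually (hf.isLittleO.def (half_pos hα))] with x hx hfx
  have hdiff := sub_eq_iff_eq_add'.2 (eq_radialPart_add hu2 hu x)
  rw [hfx, radialPart, hrad] at hx
  rw [← radialPart, hdiff] at hx
  have hb := hx.trans (mul_le_mul_of_nonneg_left (norm_smul_circleTangent_add_le hu _ _)
    (half_pos hα).le)
  rw [map_add, map_smul, map_smul, sub_zero, zero_sub, norm_neg, Real.norm_eq_abs,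
    smul_eq_mul, smul_eq_mul] at hb
  set σ := u 0 * x 1 - u 1 * x 0
  have h1 : |σ| * |α| - |x 2| * |β| ≤ |σ * α + x 2 * β| := by
    rw [← abs_mul, ← abs_mul]
    have := abs_sub_abs_le_abs_sub (σ * α) (-(x 2 * β))
    rwa [abs_neg, sub_neg_eq_add] at this
  rw [div_mul_eq_mul_div, le_div_iff₀ (half_pos hα)]
  have h2 : |σ * α + x 2 * β| ≤ |α| / 2 * (|σ| + |x 2|) := hb
  linarith

/-- The value of `f` at `radialPart u x + (s * x₂) e + x₂ k` has the sign of its first order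
term. -/
theorem eventually_abs_sub_le {f : (Fin 3 → ℝ) → ℝ} {L : (Fin 3 → ℝ) →L[ℝ] ℝ}
    (hu2 : u 2 = 0) (hf : HasStrictFDerivAt f L u) (hrad : ∀ a : ℝ, f (a • u) = 0) (s τ : ℝ) (hτ : 0 < |τ|)
    (hs : s * L (circleTangent u) + L (Pi.single 2 1) = τ) :
    ∀ᶠ x in 𝓝 u, |f (radialPart u x + ((s * x 2) • circleTangent u + x 2 • Pi.single 2 1))
      - x 2 * τ| ≤ |τ| / 2 * |x 2| := by
  -- The displacement from the radial part has norm at most `(|s| + 1)|x₂|`, so this error constant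
  -- yields exactly `|τ| / 2 * |x₂|`.
  have hc : 0 < |τ| / 2 / (|s| + 1) := by positivity
  have ht : Tendsto (fun x => (radialPart u x + ((s * x 2) • circleTangent u
      + x 2 • Pi.single 2 1), radialPart u x)) (𝓝 u) (𝓝 (u, u)) := by
    have : Continuous fun x : Fin 3 → ℝ => (radialPart u x + ((s * x 2) • circleTangent u
      + x 2 • Pi.single 2 1), radialPart u x) := by
      have := continuous_radialPart u
      fun_prop
    simpa [radialPart_self hu, hu2] using this.tendsto u
  filter_upwards [ht.eventually (hf.isLittleO.def hc)] with x hx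
  simp only [add_sub_cancel_left] at hx
  rw [show f (radialPart u x) = 0 from hrad _, map_add, map_smul, map_smul, sub_zero,
    Real.norm_eq_abs, smul_eq_mul, smul_eq_mul] at hx
  have hb := hx.trans (mul_le_mul_of_nonneg_left (norm_smul_circleTangent_add_le hu _ _) hc.le)
  have e1 : s * x 2 * L (circleTangent u) + x 2 * L (Pi.single 2 1) = x 2 * τ := by
    rw [← hs]; ring
  rw [e1, abs_mul] at hb
  refine hb.trans (le_of_eq ?_)
  have : |s| + 1 ≠ 0 := by positivity
  field_simp

end Circle

theorem hasStrictFDerivAt_eval (G : MvPolynomial (Fin 3) ℝ) (u : Fin 3 → ℝ) :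
    HasStrictFDerivAt (fun x => eval x G) (fderiv ℝ (fun x => eval x G) u) u :=
  (AnalyticOnNhd.eval_mvPolynomial (𝕜 := ℝ) G u (Set.mem_univ u)).hasStrictFDerivAt

/-- Every zero of `f` in `z = x₂ > 0` at `x` is within `M * x₂` of a zero of `g`. -/
def ZeroNear (f g : (Fin 3 → ℝ) → ℝ) (M : ℝ) (x : Fin 3 → ℝ) : Prop :=
  0 < x 2 → f x = 0 → ∃ y, y 2 = x 2 ∧ g y = 0 ∧ ∀ i, |y i - x i| ≤ M * x 2

theorem ZeroNear.mono {f g : (Fin 3 → ℝ) → ℝ} {M M' : ℝ} (hM : M ≤ M') {x : Fin 3 → ℝ}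
    (h : ZeroNear f g M x) : ZeroNear f g M' x := by
  intro h0 h1
  obtain ⟨y, hy, hy', hb⟩ := h h0 h1
  exact ⟨y, hy, hy', fun i => (hb i).trans (by gcongr)⟩

/-- At height `x₂`, `g` changes sign on a tangential segment of length `O(x₂)` near the radial part
of `x`, and so has a zero there. A zero `x` of `f` is itself within `O(x₂)` of its radial part. -/
theorem exists_eventually_zeroNear {f g : (Fin 3 → ℝ) → ℝ} {L L' : (Fin 3 → ℝ) →L[ℝ] ℝ}
    {u : Fin 3 → ℝ} (hu2 : u 2 = 0) (hu : u 0 ^ 2 + u 1 ^ 2 = 1)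
    (hf : HasStrictFDerivAt f L u) (hL : L (circleTangent u) ≠ 0) (hfr : ∀ a : ℝ, f (a • u) = 0)
    (hg : HasStrictFDerivAt g L' u) (hL' : L' (circleTangent u) ≠ 0)
    (hgr : ∀ a : ℝ, g (a • u) = 0) (hgc : Continuous g) :
    ∃ M, ∀ᶠ x in 𝓝 u, ZeroNear f g M x := by
  obtain ⟨C, hC⟩ := eventually_abs_le_mul hu hu2 hf hL hfr
  set α := L' (circleTangent u)
  set β := L' (Pi.single 2 1)
  -- The slopes `s` and `t` make the first-order term of `g` equal to `x₂` and `-x₂`.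
  set s := (1 - β) / α
  set t := (-1 - β) / α
  have hs : s * α + β = 1 := by simp only [s]; field_simp; ring
  have ht : t * α + β = -1 := by simp only [t]; field_simp; ring
  have Es := eventually_abs_sub_le hu hu2 hg hgr s 1 (by norm_num) hs
  have Et := eventually_abs_sub_le hu hu2 hg hgr t (-1) (by norm_num) ht
  refine ⟨|s| + |t| + C, ?_⟩
  filter_upwards [hC, Es, Et] with x hx hxs hxt hpos hfx
  replace hx := hx hfx
  rw [abs_of_pos hpos] at hx hxs hxt
  set Y : ℝ → Fin 3 → ℝ := fun r =>
    radialPart u x + ((r * x 2) • circleTangent u + x 2 • Pi.single 2 1)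
  have hYc : Continuous fun r => g (Y r) := by
    refine hgc.comp ?_
    simp only [Y]
    fun_prop
  have h1 : 0 ≤ g (Y s) := by
    have := (abs_le.1 hxs).1
    norm_num at this
    simp only [Y]
    linarith
  have h2 : g (Y t) ≤ 0 := by
    have := (abs_le.1 hxt).2
    norm_num at this
    simp only [Y]
    linarith
  obtain ⟨r, hr, hgr0⟩ : (0 : ℝ) ∈ (fun r => g (Y r)) '' Set.uIcc t s :=
    intermediate_value_uIcc hYc.continuousOn (Set.mem_uIcc_of_le h2 h1)
  have hrb : |r| ≤ |s| + |t| := by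
    have e1 := abs_le.1 (le_refl |s|)
    have e2 := abs_le.1 (le_refl |t|)
    have e3 := abs_nonneg s
    have e4 := abs_nonneg t
    rw [abs_le]
    rcases Set.mem_uIcc.1 hr with h | h <;> constructor <;> linarith
  refine ⟨Y r, ?_, hgr0, fun i => ?_⟩
  · simp [Y, radialPart, circleTangent, Matrix.vecHead, Matrix.vecTail, hu2]
  · have hxe := eq_radialPart_add hu2 hu x
    have : Y r - x = (r * x 2 - (u 0 * x 1 - u 1 * x 0)) • circleTangent u := by
      conv_lhs => enter [2]; rw [hxe]
      simp only [Y]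
      rw [sub_smul (r * x 2)]
      abel
    have hn : |(Y r - x) i| ≤ ‖Y r - x‖ := norm_le_pi_norm (Y r - x) i
    rw [Pi.sub_apply] at hn
    refine hn.trans ?_
    rw [this, norm_smul, Real.norm_eq_abs]
    refine (mul_le_of_le_one_right (abs_nonneg _) (norm_circleTangent_le hu)).trans ?_
    refine (abs_sub _ _).trans ?_
    rw [abs_mul, abs_of_pos hpos]
    nlinarith

/-! ### Uniformity along the circle at infinity and return to the affine plane -/

/-- The unit circle at infinity. -/
def circleAtInfinity : Set (Fin 3 → ℝ) := {u | u 2 = 0 ∧ u 0 ^ 2 + u 1 ^ 2 = 1}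

theorem isCompact_circleAtInfinity : IsCompact circleAtInfinity := by
  refine Metric.isCompact_of_isClosed_isBounded ?_ ?_
  · refine IsClosed.and ?_ ?_
    · exact isClosed_eq (by fun_prop) (by fun_prop)
    · exact isClosed_eq (by fun_prop) (by fun_prop)
  · refine (Metric.isBounded_closedBall (x := 0) (r := 1)).subset ?_
    rintro u ⟨h2, h⟩
    rw [mem_closedBall_zero_iff, pi_norm_le_iff_of_nonneg zero_le_one]
    intro i
    rw [Real.norm_eq_abs]
    fin_cases i
    · exact abs_le.2 ⟨by simp; nlinarith [sq_nonneg (u 1)], by simp; nlinarith [sq_nonneg (u 1)]⟩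
    · exact abs_le.2 ⟨by simp; nlinarith [sq_nonneg (u 0)], by simp; nlinarith [sq_nonneg (u 0)]⟩
    · simp [h2]

/-- Compactness: finitely many local constants suffice, and `ZeroNear` is monotone in the constant.
-/
theorem exists_zeroNear_nhdsSet {f g : (Fin 3 → ℝ) → ℝ}
    (h : ∀ u ∈ circleAtInfinity, ∃ M, ∀ᶠ x in 𝓝 u, ZeroNear f g M x) :
    ∃ M, ∀ᶠ x in 𝓝ˢ circleAtInfinity, ZeroNear f g M x := by
  refine isCompact_circleAtInfinity.induction_on
    (p := fun s => ∃ M, ∀ᶠ x in 𝓝ˢ s, ZeroNear f g M x) ?_ ?_ ?_ ?_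
  · exact ⟨0, by simp⟩
  · rintro s t hst ⟨M, hM⟩
    exact ⟨M, hM.filter_mono (nhdsSet_mono hst)⟩
  · rintro s t ⟨M, hM⟩ ⟨M', hM'⟩
    refine ⟨max M M', ?_⟩
    rw [nhdsSet_union, eventually_sup]
    exact ⟨hM.mono fun x => ZeroNear.mono (le_max_left _ _),
      hM'.mono fun x => ZeroNear.mono (le_max_right _ _)⟩
  · intro u hu
    obtain ⟨M, hM⟩ := h u hu
    obtain ⟨U, hU, ho, hmem⟩ := eventually_nhds_iff.1 hM
    exact ⟨U, mem_nhdsWithin_of_mem_nhds (ho.mem_nhds hmem), M,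
      by rw [ho.nhdsSet_eq]; exact hU⟩

/-- If the real zeros at infinity of the form `G` are simple and are simple zeros of `H`, then
every zero of `G` far away in the affine plane is at a bounded distance from a zero of `H`. -/
theorem exists_bound_affine {G H : MvPolynomial (Fin 3) ℝ} {n m : ℕ} (hG : G.IsHomogeneous n)
    (hH : H.IsHomogeneous m) 
    (h : ∀ u ∈ circleAtInfinity, eval u G = 0 → eval u H = 0 ∧
      fderiv ℝ (fun x => eval x G) u (circleTangent u) ≠ 0 ∧
      fderiv ℝ (fun x => eval x H) u (circleTangent u) ≠ 0) :
    ∃ M R : ℝ, ∀ a b : ℝ, R < √(a ^ 2 + b ^ 2) → eval ![a, b, 1] G = 0 →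
      ∃ a' b' : ℝ, eval ![a', b', 1] H = 0 ∧ |a' - a| ≤ M ∧ |b' - b| ≤ M := by
  have hcont (P : MvPolynomial (Fin 3) ℝ) : Continuous fun x => eval x P :=
    MvPolynomial.continuous_eval P
  obtain ⟨M, hM⟩ := exists_zeroNear_nhdsSet (f := fun x => eval x G) (g := fun x => eval x H) (by
    rintro u ⟨hu2, hu⟩
    by_cases h0 : eval u G = 0
    · obtain ⟨h1, h2, h3⟩ := h u ⟨hu2, hu⟩ h0
      exact exists_eventually_zeroNear hu2 hu (hasStrictFDerivAt_eval G u) h2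
        (fun a => by rw [hG.eval_smul_vec, h0, mul_zero]) (hasStrictFDerivAt_eval H u) h3
        (fun a => by rw [hH.eval_smul_vec, h1, mul_zero]) (hcont H)
    · refine ⟨0, ?_⟩
      filter_upwards [(hcont G).continuousAt.eventually_ne h0] with x hx _ hx'
      exact absurd hx' hx)
  obtain ⟨δ, hδ, hsub⟩ := isCompact_circleAtInfinity.exists_thickening_subset_open
    isOpen_interior (subset_interior_iff_mem_nhdsSet.2 hM)
  -- Dividing `(a, b, 1)` by `r` puts it within `1 / r` of the circle, which is less than `δ` once
  -- `r > δ⁻¹`.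
  refine ⟨M, δ⁻¹, fun a b hab hzero => ?_⟩
  set r := √(a ^ 2 + b ^ 2)
  have hr : 0 < r := (inv_pos.2 hδ).trans hab
  have hr2 : r ^ 2 = a ^ 2 + b ^ 2 := Real.sq_sqrt (by positivity)
  have hx : r⁻¹ • ![a, b, 1] ∈ {x | ZeroNear (fun x => eval x G) (fun x => eval x H) M x} := by
    refine interior_subset (hsub ?_)
    rw [Metric.mem_thickening_iff]
    refine ⟨r⁻¹ • ![a, b, 0], ⟨by simp, ?_⟩, ?_⟩
    · simp
      field_simp
      exact hr2.symm
    · have : dist (r⁻¹ • ![a, b, 1]) (r⁻¹ • ![a, b, 0]) ≤ r⁻¹ := by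
        rw [dist_pi_le_iff (by positivity)]
        intro i
        fin_cases i <;> simp [abs_of_pos hr, hr.le]
      exact this.trans_lt ((inv_lt_comm₀ hδ hr).1 hab)
  obtain ⟨y, hy2, hy, hb⟩ := hx (by simpa using hr) (by
    simp only
    rw [hG.eval_smul_vec, hzero, mul_zero])
  have hy2' : y 2 = r⁻¹ := by simpa using hy2
  have hscale : ![r * y 0, r * y 1, 1] = r • y := by
    ext i
    fin_cases i
    · simp
    · simp
    · simp [hy2', hr.ne']
  -- The error at height `1 / r` is `M / r`; scaling back by `r` leaves `M`.
  have key (c d : ℝ) (hcd : |c - r⁻¹ * d| ≤ M * r⁻¹) : |r * c - d| ≤ M := by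
    have : r * c - d = r * (c - r⁻¹ * d) := by field_simp
    rw [this, abs_mul, abs_of_pos hr]
    calc _ ≤ r * (M * r⁻¹) := by gcongr
      _ = M := by field_simp
  refine ⟨r * y 0, r * y 1, ?_, key _ _ (by simpa using hb 0), key _ _ (by simpa using hb 1)⟩
  rw [hscale, hH.eval_smul_vec]
  have : eval y H = 0 := hy
  rw [this, mul_zero]

namespace HausdorffDivisor

/-! ### Zeros of a form on the line at infinity -/

/-- The restriction of a form to the line `u + t w`. -/
noncomputable def restrictLine {K : Type*} [Field K] (u w : Fin 3 → K)
    (F : MvPolynomial (Fin 3) K) : Polynomial K :=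
  aeval (fun i => Polynomial.C (u i) + Polynomial.C (w i) * Polynomial.X) F

theorem eval_restrictLine {K : Type*} [Field K] (u w : Fin 3 → K) (F : MvPolynomial (Fin 3) K)
    (t : K) : (restrictLine u w F).eval t = eval (u + t • w) F := by
  rw [restrictLine, ← Polynomial.coe_aeval_eq_eval, ← coe_aeval_eq_eval]
  simp only [RingHom.coe_coe]
  rw [← AlgHom.comp_apply]
  congr 1
  apply MvPolynomial.algHom_ext
  intro i
  simp only [AlgHom.comp_apply, aeval_X, map_add, map_mul, Polynomial.aeval_C, Polynomial.aeval_X,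
    Algebra.algebraMap_self, RingHom.id_apply, Pi.add_apply, Pi.smul_apply, smul_eq_mul, mul_comm]

theorem natDegree_restrictLine_le {K : Type*} [Field K] (u w : Fin 3 → K)
    {F : MvPolynomial (Fin 3) K} {n : ℕ} (hF : F.IsHomogeneous n) :
    (restrictLine u w F).natDegree ≤ n := by
  have := aeval_natDegree_le F (hF.totalDegree_le)
    (fun i => Polynomial.C (u i) + Polynomial.C (w i) * Polynomial.X) (n := 1)
    (fun i => by compute_degree)
  simpa [restrictLine] using this

/-- The point `w` is the point at infinity of the line `u + t w`. Exchanging `u` and `w` amounts to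
`t ↦ t⁻¹` and moves it to parameter `0`; if `F` vanished on the line, it would vanish there too. -/
theorem restrictLine_ne_zero {K : Type*} [Field K] [Infinite K] {u w : Fin 3 → K}
    {F : MvPolynomial (Fin 3) K} {n : ℕ} (hF : F.IsHomogeneous n) (hw : eval w F ≠ 0) :
    restrictLine u w F ≠ 0 := by
  intro h0
  have hz : ∀ t : K, t ≠ 0 → (restrictLine w u F).eval t = 0 := by
    intro t ht
    have : w + t • u = t • (u + t⁻¹ • w) := by
      rw [smul_add, smul_smul, mul_inv_cancel₀ ht, one_smul, add_comm]
    rw [eval_restrictLine, this, hF.eval_smul_vec, ← eval_restrictLine, h0, Polynomial.eval_zero,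
      mul_zero]
  have : restrictLine w u F = 0 := by
    refine Polynomial.eq_zero_of_infinite_isRoot _ ?_
    exact (Set.finite_singleton (0 : K)).infinite_compl.mono fun t ht => hz t ht
  apply hw
  have h1 := eval_restrictLine w u F 0
  rw [this] at h1
  simpa using h1.symm

/-- Since `F` vanishes at `u` but not at `w`, the two are not proportional; Cramer's rule then gives
the coefficients. -/
theorem exists_combination {u w : Fin 3 → ℂ} {F : MvPolynomial (Fin 3) ℂ} {n : ℕ}
    (hF : F.IsHomogeneous n) (hu2 : u 2 = 0) (hw2 : w 2 = 0) (hu : u ≠ 0) (hu0 : eval u F = 0)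
    (hw : eval w F ≠ 0) {v : Fin 3 → ℂ} (hv2 : v 2 = 0) :
    ∃ p q : ℂ, v = p • u + q • w := by
  have hdet : u 0 * w 1 - u 1 * w 0 ≠ 0 := by
    intro hdet
    have key : ∃ k : ℂ, w = k • u := by
      by_cases h0 : u 0 = 0
      · have h1 : u 1 ≠ 0 := by
          intro h1
          apply hu
          ext i
          fin_cases i <;> simp [h0, h1, hu2]
        refine ⟨w 1 / u 1, ?_⟩
        ext i
        fin_cases i
        · simp [h0] at hdet ⊢
          tauto
        · simp [h1]
        · simp [hu2, hw2]
      · refine ⟨w 0 / u 0, ?_⟩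
        ext i
        fin_cases i
        · simp [h0]
        · simp
          field_simp
          linear_combination hdet
        · simp [hu2, hw2]
    obtain ⟨k, hk⟩ := key
    apply hw
    rw [hk, hF.eval_smul_vec, hu0, mul_zero]
  obtain ⟨d, hd⟩ : ∃ d, d = u 0 * w 1 - u 1 * w 0 := ⟨_, rfl⟩
  rw [← hd] at hdet
  refine ⟨(v 0 * w 1 - v 1 * w 0) / d, (u 0 * v 1 - u 1 * v 0) / d, ?_⟩
  ext i
  fin_cases i
  · simp
    field_simp
    rw [hd]
    ring
  · simp
    field_simp
    rw [hd]
    ring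
  · simp [hu2, hw2, hv2]

/-- A binary form of degree `n` (a form restricted to `z = 0`) vanishing at `n` distinct points has
no other zeros, and its zeros are simple. -/
theorem zero_at_infinity {u w : Fin 3 → ℂ} {F : MvPolynomial (Fin 3) ℂ} {n : ℕ}
    (hF : F.IsHomogeneous n) (hu2 : u 2 = 0) (hw2 : w 2 = 0) (hu : u ≠ 0) (hu0 : eval u F = 0)
    (hw : eval w F ≠ 0) (S : Finset ProjPlane) (hcard : S.card = n)
    (hS : ∀ P ∈ S, IsAtInfinity P ∧ eval P.rep F = 0) :
    (∃ P ∈ S, ∃ k : ℂ, u = k • P.rep) ∧ (restrictLine u w F).derivative.eval 0 ≠ 0 := by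
  -- The points of `S` become parameters on `u + t w`. Only `w` itself has no parameter, and `F`
  -- does not vanish there.
  have hex : ∀ P : S, ∃ t p : ℂ, p ≠ 0 ∧ P.1.rep = p • (u + t • w) := by
    rintro ⟨P, hP⟩
    obtain ⟨⟨a, b, hab, rfl⟩, hP0⟩ := hS P hP
    obtain ⟨k, hk⟩ := Projectivization.exists_smul_eq_mk_rep ℂ _ hab
    set v := (Projectivization.mk ℂ _ hab).rep
    have hv : v ≠ 0 := Projectivization.rep_nonzero _
    have hv2 : v 2 = 0 := by rw [← hk]; simp
    obtain ⟨p, q, hpq⟩ := exists_combination hF hu2 hw2 hu hu0 hw hv2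
    have hp : p ≠ 0 := by
      rintro rfl
      rw [zero_smul, zero_add] at hpq
      have hq : q ≠ 0 := by
        rintro rfl
        exact hv (by rw [hpq, zero_smul])
      rw [hpq, hF.eval_smul_vec] at hP0
      exact (mul_ne_zero (pow_ne_zero _ hq) hw) hP0
    refine ⟨q / p, p, hp, ?_⟩
    change v = _
    rw [hpq, smul_add, smul_smul, mul_div_cancel₀ _ hp]
  choose τ p hp hτ using hex
  have hinj : Function.Injective τ := by
    intro P Q h
    apply Subtype.ext
    rw [← P.1.mk_rep, ← Q.1.mk_rep, Projectivization.mk_eq_mk_iff']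
    refine ⟨p P / p Q, ?_⟩
    rw [hτ P, hτ Q, h, smul_smul, div_mul_cancel₀ _ (hp Q)]
  set φ := restrictLine u w F
  have hφ : φ ≠ 0 := restrictLine_ne_zero hF hw
  have hsub : Finset.univ.map ⟨τ, hinj⟩ ⊆ φ.roots.toFinset := by
    intro t ht
    obtain ⟨P, -, rfl⟩ := Finset.mem_map.1 ht
    rw [Multiset.mem_toFinset, Polynomial.mem_roots hφ, Polynomial.IsRoot, eval_restrictLine]
    have := (hS P.1 P.2).2
    rw [hτ P, hF.eval_smul_vec] at this
    exact (mul_eq_zero.1 this).resolve_left (pow_ne_zero _ (hp P))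
  have hc : (Finset.univ.map ⟨τ, hinj⟩).card = n := by simp [hcard]
  have hroots : φ.roots.card ≤ n := φ.card_roots'.trans (natDegree_restrictLine_le u w hF)
  have h1 := φ.roots.toFinset_card_le
  -- A nonzero polynomial of degree at most `n` with `n` distinct roots has no others, and all are
  -- simple. The root `0` corresponds to `u`.
  have heq : Finset.univ.map ⟨τ, hinj⟩ = φ.roots.toFinset :=
    Finset.eq_of_subset_of_card_le hsub (by omega)
  have hnodup : φ.roots.Nodup := by
    rw [← Multiset.toFinset_card_eq_card_iff_nodup]
    have := congrArg Finset.card heq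
    omega
  have h0 : φ.IsRoot 0 := by
    rw [Polynomial.IsRoot, eval_restrictLine, zero_smul, add_zero, hu0]
  constructor
  · have : (0 : ℂ) ∈ Finset.univ.map ⟨τ, hinj⟩ := by
      rw [heq, Multiset.mem_toFinset, Polynomial.mem_roots hφ]
      exact h0
    obtain ⟨P, -, hP⟩ := Finset.mem_map.1 this
    replace hP : τ P = 0 := hP
    refine ⟨P.1, P.2, (p P)⁻¹, ?_⟩
    rw [hτ P, hP, zero_smul, add_zero, smul_smul, inv_mul_cancel₀ (hp P), one_smul]
  · intro hd
    have h2 := (Polynomial.one_lt_rootMultiplicity_iff_isRoot hφ).2 ⟨h0, hd⟩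
    have h3 := Multiset.nodup_iff_count_le_one.1 hnodup 0
    rw [Polynomial.count_roots] at h3
    omega

/-- Modulo `X 2`, `G` equals `G(X₀, X₁, 0)`, which vanishes as a function and hence as a polynomial.
-/
theorem X_two_dvd {K : Type*} [Field K] [Infinite K] {G : MvPolynomial (Fin 3) K}
    (h : ∀ a b : K, eval ![a, b, 0] G = 0) : X 2 ∣ G := by
  rw [← Ideal.mem_span_singleton, ← Ideal.Quotient.eq_zero_iff_mem]
  have h0 : aeval ![X 0, X 1, (0 : MvPolynomial (Fin 3) K)] G = 0 := by
    refine MvPolynomial.funext fun v => ?_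
    rw [map_zero, ← h (v 0) (v 1), ← coe_aeval_eq_eval, ← coe_aeval_eq_eval]
    simp only [RingHom.coe_coe]
    rw [← AlgHom.comp_apply]
    congr 1
    apply MvPolynomial.algHom_ext
    intro i
    fin_cases i <;> simp
  have key : (Ideal.Quotient.mkₐ K (Ideal.span {(X 2 : MvPolynomial (Fin 3) K)})).comp
      (aeval ![X 0, X 1, (0 : MvPolynomial (Fin 3) K)])
      = Ideal.Quotient.mkₐ K (Ideal.span {(X 2 : MvPolynomial (Fin 3) K)}) := by
    apply MvPolynomial.algHom_ext
    intro i
    simp only [AlgHom.comp_apply, aeval_X, Ideal.Quotient.mkₐ_eq_mk]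
    rw [eq_comm, Ideal.Quotient.eq]
    fin_cases i
    · simp
    · simp
    · simp
  have := congrArg (fun f => f G) key
  simp only [AlgHom.comp_apply, Ideal.Quotient.mkₐ_eq_mk, h0, map_zero] at this
  exact this.symm

theorem eval_map_ofReal (G : MvPolynomial (Fin 3) ℝ) (v : Fin 3 → ℝ) :
    eval (fun i => (v i : ℂ)) (map Complex.ofRealHom G) = (eval v G : ℂ) := by
  rw [eval_map]
  exact (eval₂_comp Complex.ofRealHom v G).symm

/-- By homogeneity the differential kills `u`, while `hder` says that it does not kill `w`. As `w`
is a combination of `u` and the tangent, the tangent is not killed either. -/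
theorem fderiv_circleTangent_ne_zero {G : MvPolynomial (Fin 3) ℝ} {n : ℕ}
    (hG : G.IsHomogeneous n) {u w : Fin 3 → ℝ} (hw2 : w 2 = 0) (hu : u ∈ circleAtInfinity)
    (hu0 : eval u G = 0)
    (hder : (restrictLine (fun i => (u i : ℂ)) (fun i => (w i : ℂ))
      (map Complex.ofRealHom G)).derivative.eval 0 ≠ 0) :
    fderiv ℝ (fun x => eval x G) u (circleTangent u) ≠ 0 := by
  set L := fderiv ℝ (fun x => eval x G) u
  have hline (v : Fin 3 → ℝ) : HasDerivAt (fun t : ℝ => eval (u + t • v) G) (L v) 0 := by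
    have h1 : HasDerivAt (fun t : ℝ => u + t • v) v 0 := by
      simpa using ((hasDerivAt_id (0 : ℝ)).smul_const v).const_add u
    have h2 : HasFDerivAt (fun x => eval x G) L (u + (0 : ℝ) • v) := by
      simpa using (hasStrictFDerivAt_eval G u).hasFDerivAt
    exact h2.comp_hasDerivAt 0 h1
  have hLu : L u = 0 := by
    refine (hline u).unique ?_
    have : (fun t : ℝ => eval (u + t • u) G) = fun _ => 0 := by
      funext t
      rw [show u + t • u = (1 + t) • u by rw [add_smul, one_smul], hG.eval_smul_vec, hu0, mul_zero]
    rw [this]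
    exact hasDerivAt_const _ _
  have hLw : L w ≠ 0 := by
    intro h0
    apply hder
    set φ := restrictLine (fun i => (u i : ℂ)) (fun i => (w i : ℂ)) (map Complex.ofRealHom G)
    have h1 : HasDerivAt (fun t : ℝ => φ.eval (t : ℂ)) (φ.derivative.eval ((0 : ℝ) : ℂ)) 0 :=
      (φ.hasDerivAt _).comp_ofReal
    have h2 := (hline w).ofReal_comp
    rw [h0] at h2
    rw [← Complex.ofReal_zero]
    refine (h1.unique ?_).trans Complex.ofReal_zero
    convert! h2 using 1
    funext t
    rw [eval_restrictLine, ← eval_map_ofReal]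
    congr 2
    funext i
    simp
  intro hLe
  apply hLw
  rw [eq_radialPart_add hu.1 hu.2 w, map_add, map_add, map_smul, map_smul, radialPart, map_smul,
    hLu, hLe, hw2]
  simp

/-! ### Curves in the linear system of a Hausdorff divisor -/

section Curve

variable {n : ℕ} (C : PlaneCurve n)

theorem PlaneCurve.isHomogeneous_form : C.form.IsHomogeneous n :=
  (mem_homogeneousSubmodule _ _).1 C.rep.2

theorem PlaneCurve.mem_realAffinePart (p : EuclideanSpace ℝ (Fin 2)) :
    p ∈ C.realAffinePart ↔ eval ![(p 0 : ℂ), (p 1 : ℂ), 1] C.form = 0 := by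
  have : eval (fun i => (p i : ℂ)) C.affinePoly = eval ![(p 0 : ℂ), (p 1 : ℂ), 1] C.form := by
    rw [affinePoly, ← coe_aeval_eq_eval, ← coe_aeval_eq_eval]
    simp only [RingHom.coe_coe]
    rw [← AlgHom.comp_apply]
    congr 1
    apply MvPolynomial.algHom_ext
    intro i
    fin_cases i <;> simp
  rw [realAffinePart, Set.mem_ofPred_eq, this]

theorem PlaneCurve.eval_rep_eq_zero {D : Divisor} (hD : D.IsHausdorff)
    {C : PlaneCurve n} (h : C ∈ linearSystem n D) {P : ProjPlane} (hP : P ∈ D.support) :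
    eval P.rep C.form = 0 := by
  simpa using h P [] (by simp [(hD P hP).1])

theorem Divisor.IsHausdorff.card_support {D : Divisor} (hD : D.IsHausdorff)
    (hdeg : Finsupp.degree D = (n : ℤ)) : D.support.card = n := by
  rw [Finsupp.degree_apply, Finset.sum_congr rfl fun P hP => (hD P hP).1] at hdeg
  simpa using hdeg

/-- A real equation of a real irreducible curve. -/
theorem PlaneCurve.exists_real_equation (hn : n ≠ 0) {C : PlaneCurve n} (hreal : C.IsReal)
    (hirr : C.IsIrreducible) (hdeg : C.affineDegree = n) :
    ∃ G : MvPolynomial (Fin 3) ℝ, G.IsHomogeneous n ∧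
      (∀ v, eval v C.form = 0 ↔ eval v (map Complex.ofRealHom G) = 0) ∧
      ∃ w : Fin 3 → ℝ, w 2 = 0 ∧ eval w G ≠ 0 := by
  obtain ⟨c, G, hc, hG, hCG⟩ := exists_real_form C.isHomogeneous_form hirr (by
    intro hfin
    refine hreal ?_
    refine (hfin.preimage (f := fun p : EuclideanSpace ℝ (Fin 2) => (p 0, p 1)) ?_).subset ?_
    · intro p _ q _ h
      ext i
      fin_cases i
      · exact congrArg Prod.fst h
      · exact congrArg Prod.snd h
    · intro p hp
      exact (C.mem_realAffinePart p).1 hp)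
  refine ⟨G, hG, fun v => ?_, ?_⟩
  · rw [hCG, map_mul, eval_C, mul_eq_zero, or_iff_right hc]
  -- Otherwise `z` divides the irreducible form, which is then a multiple of `z`; its affine
  -- polynomial would be constant, of degree `0 ≠ n`.
  · by_contra! hno
    obtain ⟨Q, hQ⟩ := X_two_dvd (G := G) fun a b => hno ![a, b, 0] (by simp)
    have hdvd : C.form = X 2 * (MvPolynomial.C c * map Complex.ofRealHom Q) := by
      rw [hCG, hQ, map_mul, map_X]
      ring
    obtain hX | hQ' := hirr.isUnit_or_isUnit hdvd
    · exact (MvPolynomial.X_prime (R := ℂ) (i := (2 : Fin 3))).not_isUnit hX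
    · obtain ⟨k, -, hk⟩ := MvPolynomial.isUnit_iff_eq_C_of_isReduced.1 hQ'
      apply hn
      rw [← hdeg, affineDegree, affinePoly, hdvd, hk]
      simp

/-- Far away, the real points of `C₁` are at a bounded distance from `C₂`. -/
theorem PlaneCurve.exists_edist_le (hn : n ≠ 0) {D : Divisor} (hD : D.IsHausdorff)
    (hdeg : Finsupp.degree D = (n : ℤ)) {C₁ C₂ : PlaneCurve n}
    (h₁ : C₁ ∈ linearSystem n D) (h₂ : C₂ ∈ linearSystem n D)
    (hreal₁ : C₁.IsReal) (hreal₂ : C₂.IsReal)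
    (hirr₁ : C₁.IsIrreducible) (hirr₂ : C₂.IsIrreducible)
    (hdeg₁ : C₁.affineDegree = n) (hdeg₂ : C₂.affineDegree = n) :
    ∃ M : ℝ, ∀ p ∈ C₁.realAffinePart, ∃ q ∈ C₂.realAffinePart, dist p q ≤ M := by
  obtain ⟨G, hG, hCG, w, hw2, hw⟩ := exists_real_equation hn hreal₁ hirr₁ hdeg₁
  obtain ⟨H, hH, hCH, z, hz2, hz⟩ := exists_real_equation hn hreal₂ hirr₂ hdeg₂
  have aff (P : MvPolynomial (Fin 3) ℝ) (a b : ℝ) :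
      eval ![(a : ℂ), (b : ℂ), 1] (map Complex.ofRealHom P) = 0 ↔ eval ![a, b, 1] P = 0 := by
    rw [← Complex.ofReal_eq_zero, ← eval_map_ofReal]
    have : ![(a : ℂ), (b : ℂ), 1] = fun i => ((![a, b, 1] : Fin 3 → ℝ) i : ℂ) := by
      funext i
      fin_cases i <;> simp
    rw [this]
  have hz₁ : ∀ P ∈ D.support, IsAtInfinity P ∧ eval P.rep (map Complex.ofRealHom G) = 0 :=
    fun P hP => ⟨(hD P hP).2, (hCG _).1 (eval_rep_eq_zero hD h₁ hP)⟩
  have hz₂ : ∀ P ∈ D.support, IsAtInfinity P ∧ eval P.rep (map Complex.ofRealHom H) = 0 :=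
    fun P hP => ⟨(hD P hP).2, (hCH _).1 (eval_rep_eq_zero hD h₂ hP)⟩
  have hcard := hD.card_support hdeg
  obtain ⟨M, R, hMR⟩ := exists_bound_affine hG hH (by
    intro u hu hu0
    have hu2 : ((u 2 : ℝ) : ℂ) = 0 := by rw [hu.1, Complex.ofReal_zero]
    have hune : (fun i => (u i : ℂ)) ≠ 0 := by
      intro h
      have e (i : Fin 3) : u i = 0 := Complex.ofReal_eq_zero.1 (congrFun h i)
      have := hu.2
      rw [e 0, e 1] at this
      norm_num at this
    have real_ne {P : MvPolynomial (Fin 3) ℝ} {v : Fin 3 → ℝ} (h : eval v P ≠ 0) :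
        eval (fun i => (v i : ℂ)) (map Complex.ofRealHom P) ≠ 0 := by
      rw [eval_map_ofReal]
      exact_mod_cast h
    have real_eq {P : MvPolynomial (Fin 3) ℝ} {v : Fin 3 → ℝ} (h : eval v P = 0) :
        eval (fun i => (v i : ℂ)) (map Complex.ofRealHom P) = 0 := by
      rw [eval_map_ofReal, h, Complex.ofReal_zero]
    obtain ⟨⟨P, hP, k, hk⟩, hder₁⟩ := zero_at_infinity (hG.map Complex.ofRealHom)
      hu2 (by simp [hw2]) hune (real_eq hu0) (real_ne hw) D.support hcard hz₁
    -- The zero `u` of `G` represents a point of the divisor, through which the second curve also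
    -- passes.
    have hHu : eval u H = 0 := by
      rw [← Complex.ofReal_eq_zero, ← eval_map_ofReal, hk, (hH.map _).eval_smul_vec, (hz₂ P hP).2,
        mul_zero]
    obtain ⟨-, hder₂⟩ := zero_at_infinity (hH.map Complex.ofRealHom)
      hu2 (by simp [hz2]) hune (real_eq hHu) (real_ne hz) D.support hcard hz₂
    exact ⟨hHu, fderiv_circleTangent_ne_zero hG hw2 hu hu0 hder₁,
      fderiv_circleTangent_ne_zero hH hz2 hu hHu hder₂⟩)
  obtain ⟨q₀, hq₀⟩ := hreal₂.nonempty
  -- `R + ‖q₀‖` covers the points in the disc of radius `R`, all compared with `q₀`. Outside it,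
  -- coordinatewise bounds `M` give Euclidean distance at most `√2 M ≤ M + M`.
  refine ⟨max (M + M) (R + ‖q₀‖), fun p hp => ?_⟩
  by_cases hpR : ‖p‖ ≤ R
  · refine ⟨q₀, hq₀, le_max_of_le_right ?_⟩
    rw [dist_eq_norm]
    exact (norm_sub_le _ _).trans (by gcongr)
  · have hnorm : ‖p‖ = √(p 0 ^ 2 + p 1 ^ 2) := by
      simp [EuclideanSpace.norm_eq, Fin.sum_univ_two]
    rw [hnorm, not_le] at hpR
    obtain ⟨a, b, hab, ha, hb⟩ := hMR (p 0) (p 1) hpR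
      ((aff G _ _).1 ((hCG _).1 ((C₁.mem_realAffinePart p).1 hp)))
    refine ⟨!₂[a, b], ?_, le_max_of_le_left ?_⟩
    · rw [mem_realAffinePart]
      exact (hCH _).2 ((aff H _ _).2 hab)
    · rw [EuclideanSpace.dist_eq, Fin.sum_univ_two]
      have hM : 0 ≤ M := (abs_nonneg _).trans ha
      refine Real.sqrt_le_iff.2 ⟨by linarith, ?_⟩
      have e0 : dist (p 0) a ≤ M := by rwa [Real.dist_eq, abs_sub_comm]
      have e1 : dist (p 1) b ≤ M := by rwa [Real.dist_eq, abs_sub_comm]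
      have f0 := pow_le_pow_left₀ dist_nonneg e0 2
      have f1 := pow_le_pow_left₀ dist_nonneg e1 2
      simp
      nlinarith

end Curve

end HausdorffDivisor

end

theorem theorem2p9 (n : ℕ) (hn : 0 < n) (D : HausdorffDivisor.Divisor)
    (hD : D.IsHausdorff) (hdeg : Finsupp.degree D = (n : ℤ))
    (C₁ C₂ : HausdorffDivisor.PlaneCurve n)
    (h₁ : C₁ ∈ HausdorffDivisor.linearSystem n D)
    (h₂ : C₂ ∈ HausdorffDivisor.linearSystem n D)
    (hreal₁ : C₁.IsReal) (hreal₂ : C₂.IsReal)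
    (hirr₁ : C₁.IsIrreducible) (hirr₂ : C₂.IsIrreducible)
    (hdeg₁ : C₁.affineDegree = n) (hdeg₂ : C₂.affineDegree = n) :
    Metric.hausdorffEDist C₁.realAffinePart C₂.realAffinePart < ⊤ := by
  have hn' : n ≠ 0 := hn.ne'
  obtain ⟨M, hM⟩ := HausdorffDivisor.PlaneCurve.exists_edist_le hn' hD hdeg h₁ h₂ hreal₁ hreal₂
    hirr₁ hirr₂ hdeg₁ hdeg₂
  obtain ⟨M', hM'⟩ := HausdorffDivisor.PlaneCurve.exists_edist_le hn' hD hdeg h₂ h₁ hreal₂ hreal₁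
    hirr₂ hirr₁ hdeg₂ hdeg₁
  refine (Metric.hausdorffEDist_le_of_mem_edist (r := ENNReal.ofReal (max M M')) ?_ ?_).trans_lt
    ENNReal.ofReal_lt_top
  · intro p hp
    obtain ⟨q, hq, hpq⟩ := hM p hp
    exact ⟨q, hq, by rw [edist_dist]; exact ENNReal.ofReal_le_ofReal (le_max_of_le_left hpq)⟩
  · intro p hp
    obtain ⟨q, hq, hpq⟩ := hM' p hp
    exact ⟨q, hq, by rw [edist_dist]; exact ENNReal.ofReal_le_ofReal (le_max_of_le_right hpq)⟩
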